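/- Let $d\ge 2$ and let $\mathcal U_1,\dots,\mathcal U_d$ be sets of strings, each placed in $\mathbb Z$ by an injective map $e_i:\mathcal U_i\to\mathbb Z$ whose image contains $\mathbb N=\{0,1,2,\dots\}$ (for instance $\mathcal U_i$ identified with $\mathbb N$ or with $\mathbb Z$). Via $(e_1,\dots,e_d)$, view $\mathcal U_1\times\dots\times\mathcal U_d$ as a subset of $\mathbb Z^d$. A language is an infinite subset of $\mathcal U_1\times\dots\times\mathcal U_d$. Model. Given a collection $\mathcal X$ of languages, an adversary chooses $K\in\mathcal X$ and enumerates it as $w_0,w_1,w_2,\dots$, listing each element of $K$ exactly once and nothing else. An algorithm is a map from finite sequences of elements of $\mathcal U_1\times\dots\times\mathcal U_d$ to $\mathcal U_1\times\dots\times\mathcal U_d$; at time $t$ it outputs $o_t$, its value at $(w_0,\dots,w_t)$. It generates in the limit for $\mathcal X$ if for every $K\in\mathcal X$ and every enumeration of $K$ there is $t^*$ such that $o_t\in K\setminus\{w_0,\dots,w_t\}$ for all $t\ge t^*$. Let $O=\{o_t: t\ge 0\}$. Density. For $A,B\subseteq\mathbb Z^d$, the filtered lower Banach density of $A$ in $B$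 is $$\delta(A,B)=\liminf_{|R\cap B|\gg \mathrm{polylog}\,\mathrm{Vol}(R)}\frac{|R\cap A\cap B|}{|R\cap B|},$$ that is, the infimum of $\liminf_{n}|R_n\cap A\cap B|/|R_n\cap B|$ over all sequences $(R_n)$ of axis-parallel rectangles $\prod_i([a_i,b_i]\cap\mathbb Z)$ with $|R_n\cap B|/(\log \mathrm{Vol}(R_n))^c\to\infty$ for every integer $c\ge 0$, where $\mathrm{Vol}(R)$ is the number of lattice points of $R$ (and $\delta(A,B)=\infty$ if there is no such sequence). Let $\delta^{\square}(A,B)$ be the same quantity with the $R_n$ restricted to squares, i.e. rectangles all of whose sides have equal length. Statement. There is a countable collection $\mathcal X$ of languages in $\mathcal U_1\times\dots\times\mathcal U_d$ such that, for every algorithm that generates in the limit for $\mathcal X$, there are a language $K\in\mathcal X$ and an enumeration of $K$ by the adversary for which the set $O$ of the algorithm's outputs satisfies $$\delta(O,K)=0\qquad\text{and}\qquad \delta^{\square}(O,K)=0.$$ -/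

import Mathlib

open Filter

/-! ### Language generation in the limit -/

section Generation

variable {S : Type*}

/-- `w 0, w 1, w 2, …` is an enumeration of the language `K`: every string of `K` is listed exactly
once, and nothing else is listed. -/
def Enumerates (w : ℕ → S) (K : Set S) : Prop :=
  Function.Injective w ∧ Set.range w = K

/-- The string that the algorithm `A` outputs at time `t`, after the adversary has revealed
`w 0, …, w t`. An algorithm is an arbitrary map from finite histories to strings. -/
def outputAt (A : List S → S) (w : ℕ → S) (t : ℕ) : S :=
  A ((List.range (t + 1)).map w)

/-- All strings that the algorithm `A` ever outputs against the enumeration `w`. -/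
def outputSet (A : List S → S) (w : ℕ → S) : Set S :=
  Set.range (outputAt A w)

/-- `A` generates in the limit for the collection `X`: whichever `K ∈ X` the adversary chooses and
however it enumerates `K`, from some time on every output lies in `K` and is not among the strings
revealed so far. -/
def GeneratesInLimit (A : List S → S) (X : Set (Set S)) : Prop :=
  ∀ K ∈ X, ∀ w : ℕ → S, Enumerates w K →
    ∃ t₀ : ℕ, ∀ t ≥ t₀, outputAt A w t ∈ K ∧ ∀ s ≤ t, outputAt A w t ≠ w s

end Generation

/-! ### Filtered lower Banach density in `ℤ^d` -/

section Density

variable {d : ℕ}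

/-- The axis-parallel rectangles `∏ [aᵢ, bᵢ]` of lattice points of `ℤ^d`. -/
def axisRectangles (d : ℕ) : Set (Finset (Fin d → ℤ)) :=
  {R | ∃ a b : Fin d → ℤ, a ≤ b ∧ R = Finset.Icc a b}

/-- The axis-parallel squares of `ℤ^d`: rectangles with `ℓ ≥ 1` lattice points along each side. -/
def axisSquares (d : ℕ) : Set (Finset (Fin d → ℤ)) :=
  {R | ∃ (a : Fin d → ℤ) (ℓ : ℕ), 1 ≤ ℓ ∧ R = Finset.Icc a (fun i => a i + (ℓ - 1 : ℤ))}

/-- The regime `|R ∩ B| ≫ polylog Vol(R)`: along this filter `|R ∩ B| / (log Vol(R))^c → ∞` for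
every exponent `c` (in particular `|R ∩ B| → ∞`, the case `c = 0`). The volume of a lattice
rectangle is its number of lattice points. -/
noncomputable def nondegenerate (B : Set (Fin d → ℤ)) : Filter (Finset (Fin d → ℤ)) :=
  ⨅ c : ℕ, comap
    (fun R => (((R : Set (Fin d → ℤ)) ∩ B).ncard : ℝ) / (Real.log (R.card : ℝ)) ^ c) atTop

/-- The filtered lower Banach density of `A` in `B`, measured on the family `𝓡` of rectangles:
the liminf of `|R ∩ A ∩ B| / |R ∩ B|` over `R ∈ 𝓡` with `|R ∩ B| ≫ polylog Vol(R)`. The value is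
taken in `[0, ∞]`, so that it is `∞` (and not `0`) if there are no such rectangles. -/
noncomputable def filteredLowerBanachDensity (𝓡 : Set (Finset (Fin d → ℤ)))
    (A B : Set (Fin d → ℤ)) : ENNReal :=
  liminf
    (fun R : Finset (Fin d → ℤ) =>
      (((R : Set (Fin d → ℤ)) ∩ A ∩ B).ncard : ENNReal) / (((R : Set (Fin d → ℤ)) ∩ B).ncard : ENNReal))
    (nondegenerate B ⊓ 𝓟 𝓡)

/-- The position in `ℤ^d` of a `d`-tuple of strings, given the positions of the strings of each
`Uᵢ` in `ℤ`. -/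
def position {U : Fin d → Type*} (e : ∀ i, U i ↪ ℤ) (u : ∀ i, U i) : Fin d → ℤ :=
  fun i => e i (u i)

end Density

/-! ### Histories, enumerations and locking -/

section Locking

variable {S : Type*}

/-! The adversary's language is the set of all strings, and every rectangle that witnesses density
zero is a square listed entirely by the adversary and never hit by an output. Fix a side `n + 1`,
cut the diagonal into squares of `N = (n + 1) ^ d` points (the blocks), colour each block by `0, …,
N - 1` and all other strings by `N`. The collection consists of the sets `F ∪ {colour ≤ l}` with `F`
finite, for all `n` and `l`. A generating algorithm has locking sequences, and one history `h` can
be locked for all levels `l` at once with `F = h` (`exists_locked_colourLanguage`). The adversary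
then lists a fresh block in order of colour. Once colours `0, …, l` are out, the play is still
compatible with level `l`, so the output has colour at most `l` or lies in `h`, and is unrevealed:
it cannot be in the block. After the block is exhausted, the lock at level `N`, where the language
is everything, forbids it forever (`exists_untouched_block`). Doing this for every `n` within one
enumeration gives untouched squares of unbounded size. -/

/-- A finite history of play that is compatible with the language `L`. -/
def IsHistory (L : Set S) (h : List S) : Prop :=
  h.Nodup ∧ ∀ x ∈ h, x ∈ L

/-- After the history `h`, as long as the play stays compatible with `L`, every output of `A` is an
unrevealed string of `L`. -/
def Locked (A : List S → S) (L : Set S) (h : List S) : Prop :=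
  ∀ g, h <+: g → g ≠ [] → IsHistory L g → A g ∈ L ∧ A g ∉ g

theorem Locked.mono {A : List S → S} {L : Set S} {h h' : List S} (H : Locked A L h)
    (hh : h <+: h') : Locked A L h' :=
  fun g hg => H g (hh.trans hg)

theorem IsHistory.append_singleton {L : Set S} {h : List S} (H : IsHistory L h) {x : S}
    (hx : x ∈ L) (hxh : x ∉ h) : IsHistory L (h ++ [x]) := by
  refine ⟨?_, ?_⟩
  · rw [List.nodup_append]
    refine ⟨H.1, List.nodup_singleton x, ?_⟩
    intro a ha b hb hab
    rw [List.mem_singleton] at hb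
    exact hxh (hb ▸ hab ▸ ha)
  · intro y hy
    rw [List.mem_append, List.mem_singleton] at hy
    rcases hy with hy | rfl
    · exact H.2 y hy
    · exact hx

theorem IsHistory.exists_extend_mem {L : Set S} {h : List S} (H : IsHistory L h) {x : S}
    (hx : x ∈ L) : ∃ h', IsHistory L h' ∧ h <+: h' ∧ x ∈ h' := by
  by_cases hxh : x ∈ h
  · exact ⟨h, H, List.prefix_rfl, hxh⟩
  · exact ⟨h ++ [x], H.append_singleton hx hxh, List.prefix_append _ _, by simp⟩

theorem IsHistory.exists_extend_length {L : Set S} (hL : L.Infinite) {h : List S}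
    (H : IsHistory L h) (n : ℕ) : ∃ h', IsHistory L h' ∧ h <+: h' ∧ n ≤ h'.length := by
  induction n with
  | zero => exact ⟨h, H, List.prefix_rfl, Nat.zero_le _⟩
  | succ n ih =>
    obtain ⟨g, hg, hhg, hn⟩ := ih
    obtain ⟨x, hxL, hxg⟩ := hL.exists_notMem_finite g.finite_toSet
    exact ⟨g ++ [x], hg.append_singleton hxL hxg, hhg.trans (List.prefix_append _ _), by simpa⟩

/-- The limit of a growing sequence of histories which exhausts `L` is an enumeration of `L`. -/
theorem exists_enumerates_of_histories {L : Set S} {f : ℕ → S} (hf : ∀ x ∈ L, ∃ n, f n = x)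
    {G : ℕ → List S} (hG : ∀ n, IsHistory L (G n)) (hmono : ∀ n, G n <+: G (n + 1))
    (hmem : ∀ n, f n ∈ G (n + 1)) (hlen : ∀ n, n + 1 ≤ (G (n + 1)).length) :
    ∃ w, Enumerates w L ∧ ∀ n, (List.range (G n).length).map w = G n := by
  have hmono' : ∀ m n, m ≤ n → G m <+: G n := by
    intro m n hmn
    induction n, hmn using Nat.le_induction with
    | base => exact List.prefix_rfl
    | succ n _ ih => exact ih.trans (hmono n)
  let w : ℕ → S := fun t => (G (t + 1))[t]'(hlen t)
  have hw : ∀ n, (List.range (G n).length).map w = G n := by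
    intro n
    refine List.ext_getElem (by simp) ?_
    intro t _ h2
    simp only [List.getElem_map, List.getElem_range, w]
    rcases le_total n (t + 1) with h | h
    · exact ((hmono' _ _ h).getElem h2).symm
    · exact (hmono' _ _ h).getElem (hlen t)
  have hmemw : ∀ t n, t < n → w t ∈ G n := by
    intro t n htn
    exact (hmono' _ _ htn).subset (List.getElem_mem (hlen t))
  refine ⟨w, ⟨?_, ?_⟩, hw⟩
  · intro s t hst
    have hn := (hG (max s t + 1)).1
    rw [← hw] at hn
    have hl := hlen (max s t)
    refine List.inj_on_of_nodup_map hn ?_ ?_ hst <;> rw [List.mem_range] <;> omega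
  · ext x
    constructor
    · rintro ⟨t, rfl⟩
      exact (hG (t + 1)).2 _ (hmemw t _ t.lt_succ_self)
    · intro hx
      obtain ⟨n, rfl⟩ := hf x hx
      have := hmem n
      rw [← hw, List.mem_map] at this
      obtain ⟨t, -, ht⟩ := this
      exact ⟨t, ht⟩

/-- If every history from `h₀` on can be extended so as to satisfy `P n`, then some enumeration
has, for every `n`, a prefix longer than `n` which satisfies `P n`. -/
theorem exists_enumerates {L : Set S} (hL : L.Infinite) (hc : L.Countable) {h₀ : List S}
    (hh₀ : IsHistory L h₀) (P : ℕ → List S → Prop)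
    (H : ∀ n h, IsHistory L h → h₀ <+: h → ∃ h', IsHistory L h' ∧ h <+: h' ∧ P n h') :
    ∃ w, Enumerates w L ∧ ∀ n, ∃ m, n < m ∧ P n ((List.range m).map w) := by
  obtain ⟨f, rfl⟩ := hc.exists_eq_range hL.nonempty
  have step : ∀ n (h : {h // IsHistory (Set.range f) h ∧ h₀ <+: h}),
      ∃ h' : {h // IsHistory (Set.range f) h ∧ h₀ <+: h},
        h.1 <+: h'.1 ∧ f n ∈ h'.1 ∧ n + 1 ≤ h'.1.length ∧ P n h'.1 := by
    rintro n ⟨h, hh, hp0⟩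
    obtain ⟨h1, hh1, hp1, hm⟩ := hh.exists_extend_mem (Set.mem_range_self n)
    -- The length is forced separately because `f` may repeat values, so that including `f n` need
    -- not lengthen the history.
    obtain ⟨h2, hh2, hp2, hl⟩ := hh1.exists_extend_length hL (n + 1)
    have hp02 := hp0.trans (hp1.trans hp2)
    obtain ⟨h3, hh3, hp3, hP⟩ := H n h2 hh2 hp02
    exact ⟨⟨h3, hh3, hp02.trans hp3⟩, hp1.trans (hp2.trans hp3), (hp2.trans hp3).subset hm,
      hl.trans hp3.length_le, hP⟩
  choose F hF using step
  let G : ℕ → {h // IsHistory (Set.range f) h ∧ h₀ <+: h} :=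
    fun n => Nat.rec ⟨h₀, hh₀, List.prefix_rfl⟩ F n
  have hG : ∀ n, G (n + 1) = F n (G n) := fun n => rfl
  obtain ⟨w, hw, hwG⟩ := exists_enumerates_of_histories (L := Set.range f) (f := f)
    (G := fun n => (G n).1) (fun x hx => hx) (fun n => (G n).2.1)
    (fun n => by simpa only [hG] using (hF n (G n)).1)
    (fun n => by simpa only [hG] using (hF n (G n)).2.1)
    (fun n => by simpa only [hG] using (hF n (G n)).2.2.1)
  refine ⟨w, hw, fun n => ⟨(G (n + 1)).1.length, (hF n (G n)).2.2.1, ?_⟩⟩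
  have := (hF n (G n)).2.2.2
  rwa [← hG, ← hwG (n + 1)] at this

theorem outputAt_pred (A : List S → S) (w : ℕ → S) {m : ℕ} (hm : 0 < m) :
    outputAt A w (m - 1) = A ((List.range m).map w) := by
  rw [outputAt, Nat.sub_add_cancel hm]

/-- Existence of locking sequences. -/
theorem GeneratesInLimit.exists_locked {A : List S → S} {X : Set (Set S)}
    (hA : GeneratesInLimit A X) {L : Set S} (hLX : L ∈ X) (hL : L.Infinite) (hc : L.Countable)
    {h : List S} (hh : IsHistory L h) :
    ∃ h', IsHistory L h' ∧ h <+: h' ∧ Locked A L h' := by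
  by_contra! hcon
  -- With no locking extension, every history extends to one where `A` errs, so some enumeration
  -- sees errors at arbitrarily late times.
  obtain ⟨w, hw, hP⟩ := exists_enumerates hL hc hh (fun _ g => ¬(A g ∈ L ∧ A g ∉ g)) (by
    intro _ g hg hhg
    have := hcon g hg hhg
    unfold Locked at this
    push Not at this
    obtain ⟨g', hp, -, hg', hbad⟩ := this
    exact ⟨g', hg', hp, fun hx => hx.2 (hbad hx.1)⟩)
  obtain ⟨t₀, ht₀⟩ := hA L hLX w hw
  obtain ⟨m, hm, hbad⟩ := hP t₀
  obtain ⟨h1, h2⟩ := ht₀ (m - 1) (by omega)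
  rw [outputAt_pred A w (by omega)] at h1 h2
  refine hbad ⟨h1, fun hmem => ?_⟩
  obtain ⟨s, hs, hsw⟩ := List.mem_map.1 hmem
  rw [List.mem_range] at hs
  exact h2 s (by omega) hsw.symm

end Locking

/-! ### Blocks that the adversary exhausts alone -/

section Blocks

variable {S : Type*}

/-- The language consisting of the strings of colour at most `l` and of finitely many others. -/
def colourLanguage (c : S → ℕ) (F : Set S) (l : ℕ) : Set S :=
  F ∪ {x | c x ≤ l}

/-- One can lock simultaneously on all the languages `colourLanguage c h' l` with `l ≥ N - j`,
where `h'` is the history itself. -/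
theorem exists_locked_colourLanguage [Countable S] {A : List S → S} {X : Set (Set S)}
    (hA : GeneratesInLimit A X) {c : S → ℕ} {N : ℕ} (hcN : ∀ x, c x ≤ N)
    (hc : {x | c x = 0}.Infinite)
    (hX : ∀ (F : Finset S) (l : ℕ), colourLanguage c F l ∈ X) (h : List S) (hh : h.Nodup)
    (j : ℕ) :
    ∃ h', h'.Nodup ∧ h <+: h' ∧
      ∀ l, N ≤ l + j → Locked A (colourLanguage c {x | x ∈ h'} l) h' := by
  classical
  have hinf : ∀ F l, (colourLanguage c F l).Infinite := fun F l =>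
    hc.mono fun x (hx : c x = 0) => Or.inr (by simp [hx])
  have lock : ∀ (g : List S) (l : ℕ), g.Nodup → ∃ g',
      IsHistory (colourLanguage c {x | x ∈ g} l) g' ∧ g <+: g' ∧
        Locked A (colourLanguage c {x | x ∈ g} l) g' := by
    intro g l hg
    have hgX := hX g.toFinset l
    rw [List.coe_toFinset] at hgX
    exact hA.exists_locked hgX (hinf _ _) (Set.to_countable _) ⟨hg, fun x hx => Or.inl hx⟩
  -- Extending `g` inside its level `l` language adds only strings of colour at most `l`, which
  -- leaves all languages of level `l' ≥ l` unchanged. Locking from the top level downwards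
  -- therefore preserves the earlier locks.
  have hstable : ∀ {g g' : List S} {l l' : ℕ}, l ≤ l' → g <+: g' →
      IsHistory (colourLanguage c {x | x ∈ g} l) g' →
        colourLanguage c {x | x ∈ g} l' = colourLanguage c {x | x ∈ g'} l' := by
    intro g g' l l' hll hp hg'
    ext x
    constructor
    · rintro (hx | hx)
      · exact Or.inl (hp.subset hx)
      · exact Or.inr hx
    · rintro (hx | hx)
      · rcases hg'.2 x hx with hx | hx
        · exact Or.inl hx
        · exact Or.inr (le_trans hx hll)
      · exact Or.inr hx
  induction j with
  | zero =>
    obtain ⟨g', hg', hp, hlock⟩ := lock h N hh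
    refine ⟨g', hg'.1, hp, fun l hl => ?_⟩
    have heq : colourLanguage c {x | x ∈ g'} l = colourLanguage c {x | x ∈ h} N := by
      ext x
      exact ⟨fun _ => Or.inr (hcN x), fun _ => Or.inr ((hcN x).trans (by simpa using hl))⟩
    rwa [heq]
  | succ j ih =>
    obtain ⟨g, hg, hpg, hlockg⟩ := ih
    obtain ⟨g', hg', hp, hlock⟩ := lock g (N - (j + 1)) hg
    refine ⟨g', hg'.1, hpg.trans hp, fun l hl => ?_⟩
    rw [← hstable (by omega) hp hg']
    by_cases hlj : N ≤ l + j
    · exact (hlockg l hlj).mono hp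
    · obtain rfl : l = N - (j + 1) := by omega
      exact hlock

/-- Against an algorithm that generates in the limit, every history can be extended so that some
block `b i` is exhausted by the adversary and never touched by the algorithm. -/
theorem exists_untouched_block [Countable S] {A : List S → S} {X : Set (Set S)}
    (hA : GeneratesInLimit A X) {N : ℕ} (hN : 0 < N) {b : ℕ → Fin N → S}
    (hb : Function.Injective (Function.uncurry b)) {c : S → ℕ} (hcN : ∀ x, c x ≤ N)
    (hcb : ∀ i j, c (b i j) = j)
    (hX : ∀ (F : Finset S) (l : ℕ), colourLanguage c F l ∈ X) (h : List S) (hh : h.Nodup) :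
    ∃ h', h'.Nodup ∧ h <+: h' ∧ ∃ i, ∀ g, g ≠ [] → g.Nodup → (g <+: h' ∨ h' <+: g) →
      A g ∉ Set.range (b i) := by
  classical
  have hc : {x | c x = 0}.Infinite := by
    refine Set.infinite_of_injective_forall_mem (f := fun i => b i ⟨0, hN⟩) ?_ ?_
    · intro i i' hii
      exact congrArg Prod.fst (@hb (i, ⟨0, hN⟩) (i', ⟨0, hN⟩) hii)
    · intro i
      exact hcb i ⟨0, hN⟩
  obtain ⟨h₁, hnd, hp, hlock⟩ := exists_locked_colourLanguage hA hcN hc hX h hh N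
  -- an index whose block meets neither the history nor the outputs so far
  obtain ⟨i, hi⟩ : ∃ i, ∀ j, b i j ∉ h₁ ∧ b i j ∉ h₁.inits.map A := by
    let E : Set S := {x | x ∈ h₁ ∨ x ∈ h₁.inits.map A}
    have hE : E.Finite := (h₁.finite_toSet).union (h₁.inits.map A).finite_toSet
    have hpre := (hE.preimage hb.injOn).image Prod.fst
    obtain ⟨i, hi⟩ := hpre.exists_notMem
    refine ⟨i, fun j => ?_⟩
    have : ¬ (b i j ∈ h₁ ∨ b i j ∈ h₁.inits.map A) :=
      fun hmem => hi ⟨(i, j), hmem, rfl⟩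
    exact not_or.1 this
  have hbi : Function.Injective (b i) := fun j j' hjj =>
    congrArg Prod.snd (@hb (i, j) (i, j') hjj)
  -- The block is revealed in order of colour.
  refine ⟨h₁ ++ List.ofFn (b i), ?_, hp.trans (List.prefix_append _ _), i, ?_⟩
  · rw [List.nodup_append]
    refine ⟨hnd, List.nodup_ofFn.2 hbi, ?_⟩
    rintro a ha _ hx rfl
    obtain ⟨j, rfl⟩ := List.mem_ofFn.1 hx
    exact (hi j).1 ha
  rintro g hne hg hcase ⟨j, hj⟩
  by_cases hgh : g <+: h₁
  · exact (hi j).2 (hj ▸ List.mem_map_of_mem (List.mem_inits _ _ |>.2 hgh))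
  have hhg : h₁ <+: g := by
    rcases hcase with hcase | hcase
    · exact (List.prefix_or_prefix_of_prefix hcase (List.prefix_append _ _)).resolve_left hgh
    · exact (List.prefix_append _ _).trans hcase
  rcases hcase with ⟨r, hr⟩ | hcase
  · obtain ⟨q, rfl⟩ := hhg
    rw [List.append_assoc, List.append_right_inj] at hr
    have hq : q <+: List.ofFn (b i) := ⟨r, hr⟩
    have hqne : q ≠ [] := by
      rintro rfl
      exact hgh (by simp)
    have hqlen : 0 < q.length := List.length_pos_iff.2 hqne
    have hqmem : ∀ j : Fin N, b i j ∈ q ↔ (j : ℕ) < q.length := by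
      intro j
      constructor
      · intro hj
        obtain ⟨k, hk, hkj⟩ := List.getElem_of_mem hj
        rw [hq.getElem hk, List.getElem_ofFn] at hkj
        rw [← hbi hkj]
        exact hk
      · intro hj
        have := List.getElem_mem hj
        rwa [hq.getElem hj, List.getElem_ofFn] at this
    have hqsub : ∀ x ∈ q, ∃ j, b i j = x := fun x hx => List.mem_ofFn.1 (hq.subset hx)
    -- The revealed part `q` of the block has colours `0, …, q.length - 1`. At level `q.length - 1`
    -- the block strings of the language are exactly those in `q`, and these are no longer allowed
    -- as outputs.
    obtain ⟨hmem, hnot⟩ := hlock (q.length - 1) (by omega) _ (List.prefix_append h₁ q) hne ⟨hg, by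
      intro x hx
      rw [List.mem_append] at hx
      rcases hx with hx | hx
      · exact Or.inl hx
      · obtain ⟨j, rfl⟩ := hqsub x hx
        refine Or.inr ?_
        have := (hqmem j).1 hx
        simp only [Set.mem_ofPred_eq, hcb]
        omega⟩
    rw [← hj] at hmem hnot
    rcases hmem with hmem | hmem
    · exact (hi j).1 hmem
    · refine hnot (List.mem_append_right _ ((hqmem j).2 ?_))
      simp only [Set.mem_ofPred_eq, hcb] at hmem
      omega
  · refine (hlock N (by omega) g hhg hne ⟨hg, fun x _ => Or.inr (hcN x)⟩).2 ?_
    rw [← hj]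
    exact hcase.subset (List.mem_append_right _ (List.mem_ofFn.2 ⟨j, rfl⟩))

end Blocks

/-! ### Squares in `ℤ^d` -/

section Squares

variable {d : ℕ}

theorem tendsto_div_log_pow_atTop (c : ℕ) :
    Tendsto (fun x : ℝ => x / Real.log x ^ c) atTop atTop := by
  have h := Real.tendsto_pow_log_div_mul_add_atTop 1 0 c one_ne_zero
  have h2 : Tendsto (fun x : ℝ => Real.log x ^ c / (1 * x + 0)) atTop (nhdsWithin 0 (Set.Ioi 0)) := by
    refine tendsto_nhdsWithin_iff.2 ⟨h, ?_⟩
    filter_upwards [eventually_gt_atTop (1 : ℝ)] with x hx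
    have := Real.log_pos hx
    simp only [Set.mem_Ioi]
    positivity
  refine (tendsto_inv_nhdsGT_zero.comp h2).congr fun x => ?_
  simp

/-- Finite sets `R n ⊆ B` of size tending to infinity satisfy `|R n ∩ B| ≫ polylog Vol (R n)`. -/
theorem tendsto_nondegenerate {B : Set (Fin d → ℤ)} {R : ℕ → Finset (Fin d → ℤ)}
    (hRB : ∀ n, (R n : Set (Fin d → ℤ)) ⊆ B) (hR : Tendsto (fun n => (R n).card) atTop atTop) :
    Tendsto R atTop (nondegenerate B) := by
  refine tendsto_iInf.2 fun c => tendsto_comap_iff.2 ?_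
  refine ((tendsto_div_log_pow_atTop c).comp (tendsto_natCast_atTop_atTop.comp hR)).congr ?_
  intro n
  simp [Set.inter_eq_left.2 (hRB n)]

/-- The ratio vanishes along a sequence that tends to the filter, hence frequently; that sequence
also shows that the filter is nontrivial, so the value is not `∞`. -/
theorem filteredLowerBanachDensity_eq_zero {𝓡 : Set (Finset (Fin d → ℤ))} {A B : Set (Fin d → ℤ)}
    {R : ℕ → Finset (Fin d → ℤ)} (h𝓡 : ∀ n, R n ∈ 𝓡) (hRB : ∀ n, (R n : Set (Fin d → ℤ)) ⊆ B)
    (hR : Tendsto (fun n => (R n).card) atTop atTop)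
    (hRA : ∀ n, Disjoint (R n : Set (Fin d → ℤ)) A) :
    filteredLowerBanachDensity 𝓡 A B = 0 := by
  have ht : Tendsto R atTop (nondegenerate B ⊓ 𝓟 𝓡) :=
    tendsto_inf.2 ⟨tendsto_nondegenerate hRB hR, tendsto_principal.2 (.of_forall h𝓡)⟩
  refine le_antisymm (liminf_le_of_frequently_le' (ht.frequently (.of_forall fun n => ?_))) bot_le
  simp [Set.disjoint_iff_inter_eq_empty.1 (hRA n)]

theorem axisSquares_subset_axisRectangles : axisSquares d ⊆ axisRectangles d := by
  rintro _ ⟨a, ℓ, hℓ, rfl⟩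
  refine ⟨a, _, fun i => ?_, rfl⟩
  have : (1 : ℤ) ≤ ℓ := by exact_mod_cast hℓ
  dsimp only
  omega

/-- The `i`-th square of side `m` along the diagonal. -/
noncomputable def diagonalSquare (d m i : ℕ) : Finset (Fin d → ℤ) :=
  Finset.Icc (fun _ => (i * m : ℤ)) (fun _ => (i * m + (m - 1) : ℤ))

theorem diagonalSquare_mem_axisSquares {m : ℕ} (hm : 1 ≤ m) (i : ℕ) :
    diagonalSquare d m i ∈ axisSquares d :=
  ⟨fun _ => (i * m : ℤ), m, hm, rfl⟩

theorem card_diagonalSquare (m i : ℕ) : (diagonalSquare d m i).card = m ^ d := by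
  simp [diagonalSquare, Pi.card_Icc, add_assoc]

theorem eq_of_mem_diagonalSquare (hd : 0 < d) {m i i' : ℕ} {p : Fin d → ℤ}
    (hp : p ∈ diagonalSquare d m i) (hp' : p ∈ diagonalSquare d m i') : i = i' := by
  have key : ∀ {i i' : ℕ}, p ∈ diagonalSquare d m i → p ∈ diagonalSquare d m i' → i ≤ i' := by
    intro i i' h h'
    have h1 := (Finset.mem_Icc.1 h).1 ⟨0, hd⟩
    have h2 := (Finset.mem_Icc.1 h').2 ⟨0, hd⟩
    dsimp only at h1 h2
    by_contra! hlt
    have : ((i' : ℤ) + 1) * m ≤ i * m := by gcongr; exact_mod_cast hlt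
    linarith
  exact le_antisymm (key hp hp') (key hp' hp)

theorem position_injective {U : Fin d → Type*} (e : ∀ i, U i ↪ ℤ) :
    Function.Injective (position e) :=
  fun _ _ h => funext fun i => (e i).injective (congrFun h i)

theorem mem_range_position {U : Fin d → Type*} {e : ∀ i, U i ↪ ℤ}
    (he : ∀ i, ∀ n : ℕ, (n : ℤ) ∈ Set.range (e i)) {p : Fin d → ℤ} (hp : 0 ≤ p) :
    p ∈ Set.range (position e) := by
  have : ∀ i, ∃ u, e i u = p i := by
    intro i
    obtain ⟨n, hn⟩ := Int.eq_ofNat_of_zero_le (hp i)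
    rw [hn]
    exact he i n
  choose u hu using this
  exact ⟨u, funext hu⟩

theorem diagonalSquare_subset_range_position {U : Fin d → Type*} {e : ∀ i, U i ↪ ℤ}
    (he : ∀ i, ∀ n : ℕ, (n : ℤ) ∈ Set.range (e i)) (m i : ℕ) :
    (diagonalSquare d m i : Set (Fin d → ℤ)) ⊆ Set.range (position e) := by
  intro p hp
  refine mem_range_position he (le_trans (fun _ => ?_) (Finset.mem_Icc.1 hp).1)
  positivity

/-- The strings positioned in the diagonal squares of side `m`, listed square by square. -/
theorem exists_blocks (hd : 0 < d) {U : Fin d → Type*} {e : ∀ i, U i ↪ ℤ}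
    (he : ∀ i, ∀ n : ℕ, (n : ℤ) ∈ Set.range (e i)) (m : ℕ) :
    ∃ b : ℕ → Fin (m ^ d) → (∀ i, U i), Function.Injective (Function.uncurry b) ∧
      ∀ i, position e '' Set.range (b i) = diagonalSquare d m i := by
  let E := fun i => Finset.equivFinOfCardEq (card_diagonalSquare (d := d) m i)
  have : ∀ i (j : Fin (m ^ d)), ∃ u, position e u = ((E i).symm j : Fin d → ℤ) := fun i j =>
    diagonalSquare_subset_range_position he m i ((E i).symm j).2
  choose b hb using this
  refine ⟨b, ?_, fun i => ?_⟩
  · rintro ⟨i, j⟩ ⟨i', j'⟩ h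
    have h' : ((E i).symm j : Fin d → ℤ) = ((E i').symm j' : Fin d → ℤ) := by
      rw [← hb, ← hb]
      exact congrArg _ h
    obtain rfl : i = i' := eq_of_mem_diagonalSquare hd ((E i).symm j).2 (h' ▸ ((E i').symm j').2)
    rw [(E i).symm.injective (Subtype.ext h')]
  · ext p
    simp only [Set.mem_image, Set.mem_range, exists_exists_eq_and, hb, Finset.mem_coe]
    exact ⟨fun ⟨j, hj⟩ => hj ▸ ((E i).symm j).2, fun hp => ⟨E i ⟨p, hp⟩, by simp⟩⟩

end Squares

theorem mainTheorem8 (d : ℕ) (hd : 2 ≤ d) (U : Fin d → Type*) (e : ∀ i, U i ↪ ℤ)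
    (he : ∀ i, ∀ n : ℕ, (n : ℤ) ∈ Set.range (e i)) :
    ∃ X : Set (Set (∀ i, U i)), X.Countable ∧ (∀ L ∈ X, L.Infinite) ∧
      ∀ A : List (∀ i, U i) → (∀ i, U i), GeneratesInLimit A X →
        ∃ K ∈ X, ∃ w : ℕ → (∀ i, U i), Enumerates w K ∧
          filteredLowerBanachDensity (axisRectangles d)
            (position e '' outputSet A w) (position e '' K) = 0 ∧
          filteredLowerBanachDensity (axisSquares d)
            (position e '' outputSet A w) (position e '' K) = 0 := by
  classical
  have : ∀ i, Countable (U i) := fun i => (e i).injective.countable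
  have hd0 : 0 < d := by omega
  choose b hb hbR using fun n : ℕ => exists_blocks hd0 he (n + 1)
  -- Strings outside the blocks get the top colour, so they enter a language only through `F` or at
  -- levels `l ≥ (n + 1) ^ d`.
  let c : ℕ → (∀ i, U i) → ℕ := fun n =>
    Function.extend (Function.uncurry (b n)) (fun p => (p.2 : ℕ)) (fun _ => (n + 1) ^ d)
  have hcb : ∀ n i j, c n (b n i j) = j := fun n i j => (hb n).extend_apply _ _ (i, j)
  have hcN : ∀ n x, c n x ≤ (n + 1) ^ d := by
    intro n x
    by_cases hx : ∃ p, Function.uncurry (b n) p = x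
    · obtain ⟨⟨i, j⟩, rfl⟩ := hx
      exact (hcb n i j).trans_le j.2.le
    · exact (Function.extend_apply' _ _ _ hx).le
  have hN : ∀ n : ℕ, 0 < (n + 1) ^ d := fun n => by positivity
  let L : Finset (∀ i, U i) × ℕ × ℕ → Set (∀ i, U i) := fun q => colourLanguage (c q.2.1) q.1 q.2.2
  have hLinf : ∀ q, (L q).Infinite := by
    rintro ⟨F, n, l⟩
    refine Set.infinite_of_injective_forall_mem (f := fun i => b n i ⟨0, hN n⟩) ?_ ?_
    · intro i i' hii
      exact congrArg Prod.fst (@hb n (i, ⟨0, hN n⟩) (i', ⟨0, hN n⟩) hii)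
    · intro i
      refine Or.inr ?_
      simp [hcb]
  have huniv : L (∅, 0, (0 + 1) ^ d) = Set.univ :=
    Set.eq_univ_of_forall fun x => Or.inr (hcN 0 x)
  refine ⟨Set.range L, Set.countable_range L, ?_, fun A hA => ⟨Set.univ, ⟨_, huniv⟩, ?_⟩⟩
  · rintro _ ⟨q, rfl⟩
    exact hLinf q
  obtain ⟨w, hw, hP⟩ := exists_enumerates (huniv ▸ hLinf _) (Set.to_countable Set.univ)
    (h₀ := []) ⟨List.nodup_nil, by simp⟩
    (fun n h' => ∃ i, ∀ g, g ≠ [] → g.Nodup → (g <+: h' ∨ h' <+: g) → A g ∉ Set.range (b n i))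
    (by
      intro n h hh _
      obtain ⟨h', hnd, hp, hi⟩ := exists_untouched_block hA (hN n) (hb n) (hcN n) (hcb n)
        (fun F l => ⟨(F, n, l), rfl⟩) h hh.1
      exact ⟨h', ⟨hnd, fun _ _ => trivial⟩, hp, hi⟩)
  choose m _ i hi using hP
  have hprefix : ∀ s t, s ≤ t → (List.range s).map w <+: (List.range t).map w := by
    intro s t hst
    refine List.IsPrefix.map w (List.prefix_iff_eq_take.2 ?_)
    rw [List.length_range, List.take_range, min_eq_left hst]
  have hout : ∀ n, Disjoint (diagonalSquare d (n + 1) (i n) : Set (Fin d → ℤ))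
      (position e '' outputSet A w) := by
    intro n
    rw [← hbR, Set.disjoint_image_iff (position_injective e), Set.disjoint_right]
    rintro _ ⟨t, rfl⟩
    -- Each output answers a prefix of `w`, and two prefixes of `w` are always comparable; this
    -- covers outputs both before and after the block is exhausted.
    refine hi n _ (by simp) (List.nodup_range.map hw.1) ?_
    exact (le_total (t + 1) (m n)).imp (hprefix _ _) (hprefix _ _)
  have hsq : ∀ n, diagonalSquare d (n + 1) (i n) ∈ axisSquares d := fun n =>
    diagonalSquare_mem_axisSquares (by omega) _
  have hsub : ∀ n, (diagonalSquare d (n + 1) (i n) : Set (Fin d → ℤ)) ⊆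
      position e '' Set.univ := fun n =>
    Set.image_univ ▸ diagonalSquare_subset_range_position he _ _
  have hcard : Tendsto (fun n => (diagonalSquare d (n + 1) (i n)).card) atTop atTop := by
    refine tendsto_atTop_mono (fun n => ?_) tendsto_id
    rw [card_diagonalSquare]
    exact (Nat.le_succ n).trans (Nat.le_self_pow hd0.ne' _)
  exact ⟨w, hw, filteredLowerBanachDensity_eq_zero
      (fun n => axisSquares_subset_axisRectangles (hsq n)) hsub hcard hout,
    filteredLowerBanachDensity_eq_zero hsq hsub hcard hout⟩
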